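/- Let $\lambda$ be an infinite cardinal and let $X$ be a Hausdorff space with $|X|>1$. Write $o(Y)$ for the number of open subsets of a space $Y$, $w(Y)$ for its weight (the least cardinality of a base, plus $\omega$) and $nw(Y)$ for its network weight (the least cardinality of a network, plus $\omega$, where a network is a family $\mathcal N$ of subsets of $Y$ such that every open set is a union of members of $\mathcal N$). Let $\varphi\in\{w,nw\}$, suppose that $o(X)=2^{\varphi(X)}$, and put $\mu=o(X^\lambda)$, where $X^\lambda$ has the product topology. An infinite cardinal $\kappa$ is a caliber (resp. precaliber; weak precaliber) of a space $Y$ if for every family $\{U_\alpha:\alpha<\kappa\}$ of non-empty open subsets of $Y$, repetitions allowed, there is $J\subseteq\kappa$ with $|J|=\kappa$ such that $\bigcap_{\alpha\in J}U_\alpha\neq\emptyset$ (resp. $\{U_\alpha:\alpha\in J\}$ is centered, i.e. each of its non-empty finite subfamilies has non-empty intersection; $\{U_\alpha:\alpha\in J\}$ is linked, i.e. any two of its members meet). It is a caliber* (resp. precaliber*; weak precaliber*) of $Y$ if every set $\mathcal U$ of non-empty open subsets of $Y$ with $|\mathcal U|=\kappa$ has a subset $\mathcal V\subseteq\mathcal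 U$ with $|\mathcal V|=\kappa$ such that $\bigcap\mathcal V\neq\emptyset$ (resp. $\mathcal V$ is centered; $\mathcal V$ is linked). Let $\mathsf C(Y),\mathsf P(Y),\mathsf{WP}(Y)$ be the classes of infinite cardinals that are calibers, precalibers, weak precalibers of $Y$ respectively, and $\mathsf C^*(Y),\mathsf P^*(Y),\mathsf{WP}^*(Y)$ those of the calibers*, precalibers*, weak precalibers* of $Y$. Then for every $\mathsf A\in\{\mathsf C,\mathsf P,\mathsf{WP}\}$: 1. $\mathsf A(X^\lambda)=\{\kappa\in\mathsf A(X):\operatorname{cf}(\kappa)>\omega\}$; 2. $\mathsf A^*(X^\lambda)=\{\kappa:\kappa \text{ is an infinite cardinal and } \kappa>\mu\}\cup\{\kappa\in\mathsf A(X):\kappa\le\mu \text{ and } \operatorname{cf}(\kappa)>\omega\}$. -/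

import Mathlib

open scoped Cardinal

universe u

namespace TopCaliber

/-- A family of sets is centered when every non-empty finite subfamily has non-empty
intersection. -/
def IsCentered {X : Type u} (V : Set (Set X)) : Prop :=
  ∀ F : Set (Set X), F ⊆ V → F.Finite → F.Nonempty → (⋂₀ F).Nonempty

/-- A family of sets is linked when any two of its members meet. -/
def IsLinked {X : Type u} (V : Set (Set X)) : Prop :=
  ∀ U ∈ V, ∀ W ∈ V, (U ∩ W).Nonempty

/-- The three kinds of chain conditions: `C` (calibers), `P` (precalibers),
`WP` (weak precalibers). -/
inductive ChainKind : Type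
  | C : ChainKind
  | P : ChainKind
  | WP : ChainKind

/-- What each kind of chain condition asks of the large subfamily. -/
def ChainKind.Good {X : Type u} : ChainKind → Set (Set X) → Prop
  | .C, V => (⋂₀ V).Nonempty
  | .P, V => IsCentered V
  | .WP, V => IsLinked V

/-- `A.cardinals X` is the class of infinite cardinals that are calibers, precalibers or weak
precalibers of `X`. Families are indexed by a set `I` of cardinality `κ`, and repetitions
are allowed. -/
def ChainKind.cardinals (A : ChainKind) (X : Type u) [TopologicalSpace X] :
    Set Cardinal.{u} :=
  {κ | ℵ₀ ≤ κ ∧ ∀ I : Type u, #I = κ → ∀ U : I → Set X,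
    (∀ i, IsOpen (U i) ∧ (U i).Nonempty) → ∃ J : Set I, #J = κ ∧ A.Good (U '' J)}

/-- `A.starCardinals X` is the class of infinite cardinals that are calibers*, precalibers* or
weak precalibers* of `X`. Here the families are collections of `κ` different open sets. -/
def ChainKind.starCardinals (A : ChainKind) (X : Type u) [TopologicalSpace X] :
    Set Cardinal.{u} :=
  {κ | ℵ₀ ≤ κ ∧ ∀ 𝒰 : Set (Set X), #𝒰 = κ →
    (∀ U ∈ 𝒰, IsOpen U ∧ U.Nonempty) → ∃ 𝒱 ⊆ 𝒰, #𝒱 = κ ∧ A.Good 𝒱}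

/-- The number `o(X)` of open sets of `X`. -/
noncomputable def numOpens (X : Type u) [TopologicalSpace X] : Cardinal.{u} :=
  #{U : Set X // IsOpen U}

/-- The weight `w(X)`: the least size of a base, or `ℵ₀` if that is larger. -/
noncomputable def weight (X : Type u) [TopologicalSpace X] : Cardinal.{u} :=
  max ℵ₀ (sInf {c | ∃ B : Set (Set X), TopologicalSpace.IsTopologicalBasis B ∧ #B = c})

/-- A network of `X`: a family of (not necessarily open) sets such that every open set is a union
of members of the family. -/
def IsNetwork {X : Type u} [TopologicalSpace X] (N : Set (Set X)) : Prop :=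
  ∀ U : Set X, IsOpen U → ∀ x ∈ U, ∃ S ∈ N, x ∈ S ∧ S ⊆ U

/-- The network weight `nw(X)`: the least size of a network, or `ℵ₀` if that is larger. -/
noncomputable def networkWeight (X : Type u) [TopologicalSpace X] : Cardinal.{u} :=
  max ℵ₀ (sInf {c | ∃ N : Set (Set X), IsNetwork N ∧ #N = c})

end TopCaliber

open Set Cardinal

namespace TopCaliber

/-! ### Finite colourings injective on many finite sets -/

/-! The heart is that a chain condition of `X` at `κ` of uncountable cofinality passes to all
powers. Shrink the given open sets to boxes with finite supports. A finite colouring `c` of the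
coordinates, injective on `κ` of the supports (`colorableFamily`, which covers singular `κ` too),
encodes each such box by finitely many open sets of `X`, one per colour. Apply the chain condition
to the colours in turn; witnesses `x k` then combine to the point `i ↦ x (c i)` of the power.

Conversely, projections return the condition to `X`, and an infinite disjoint sequence of open sets
in the power excludes countable cofinality. For the starred classes, cardinals above `μ` qualify
vacuously; up to `μ`, every non-empty open set has enough open subsets to refine an indexed family
to one without repetitions. -/

/-- Some subfamily of full size admits a finite colouring of the points which is injective on
each of its members. -/
def ColorableFamily {I ι : Type u} (F : I → Finset ι) : Prop :=
  ∃ J : Set I, #J = #I ∧ ∃ (m : ℕ) (c : ι → Fin m), ∀ a ∈ J, InjOn c (F a)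

theorem exists_fin_injOn {ι : Type u} (s : Finset ι) {m : ℕ} (h : s.card ≤ m) :
    ∃ c : ι → Fin (m + 1), InjOn c s := by
  classical
  refine ⟨fun i => if hi : i ∈ s then ⟨s.equivFin ⟨i, hi⟩, by omega⟩ else 0, ?_⟩
  intro i hi j hj hij
  simp only [Finset.mem_coe] at hi hj
  simpa [hi, hj, Fin.ext_iff, ← Fin.ext_iff] using hij

theorem ColorableFamily.of_const {I ι : Type u} (F : I → Finset ι) (s : Finset ι)
    (h : #(F ⁻¹' {s}) = #I) : ColorableFamily F := by
  obtain ⟨c, hc⟩ := exists_fin_injOn s le_rfl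
  refine ⟨_, h, _, c, fun a ha => ?_⟩
  rw [show F a = s from ha]
  exact hc

theorem ColorableFamily.of_pairwiseDisjoint {I ι : Type u} (F : I → Finset ι) (n : ℕ)
    (hn : ∀ a, (F a).card ≤ n) (M : Set I) (hM : M.PairwiseDisjoint F) (h : #M = #I) :
    ColorableFamily F := by
  classical
  choose g hg using fun a => exists_fin_injOn (F a) (hn a)
  refine ⟨M, h, n + 1, fun i => if h : ∃ a ∈ M, i ∈ F a then g h.choose i else 0, ?_⟩
  have key : ∀ a ∈ M, ∀ i ∈ F a,
      (if h : ∃ a ∈ M, i ∈ F a then g h.choose i else 0) = g a i := by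
    intro a ha i hi
    have h : ∃ a ∈ M, i ∈ F a := ⟨a, ha, hi⟩
    rw [dif_pos h]
    obtain ⟨h1, h2⟩ := h.choose_spec
    by_cases hne : h.choose = a
    · rw [hne]
    · exact absurd hi (Finset.disjoint_left.1 (hM h1 ha hne) h2)
  intro a ha i hi j hj hij
  simp only at hij
  rw [key a ha i hi, key a ha j hj] at hij
  exact hg a hi hj hij

/-- Reduction of the colouring lemma to families with few distinct members. -/
theorem ColorableFamily.of_few_values {ι : Type u} {κ : Cardinal.{u}} (hκ : ℵ₀ < κ)
    (H : ∀ (I : Type u) (F : I → Finset ι), #I = κ → #(range F) < κ → ColorableFamily F)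
    (n : ℕ) : ∀ (I : Type u) (F : I → Finset ι), #I = κ → (∀ a, (F a).card ≤ n) →
      ColorableFamily F := by
  classical
  induction n with
  | zero =>
    intro I F hI hF
    refine .of_const F ∅ ?_
    have : F ⁻¹' {∅} = Set.univ := by
      ext a; simpa using hF a
    rw [this, mk_univ]
  | succ n ih =>
    intro I F hI hF
    obtain ⟨M, -, hM⟩ : ∃ M, ∅ ⊆ M ∧ Maximal (fun M : Set I => M.PairwiseDisjoint F) M := by
      refine zorn_subset_nonempty {M : Set I | M.PairwiseDisjoint F} ?_ ∅ (by simp)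
      intro c hc hchain _
      refine ⟨⋃₀ c, ?_, fun s hs => subset_sUnion_of_mem hs⟩
      exact (pairwiseDisjoint_sUnion hchain.directedOn).2 hc
    by_cases hMc : #M = #I
    · exact .of_pairwiseDisjoint F _ hF M hM.prop hMc
    have hMlt : #M < κ := hI ▸ lt_of_le_of_ne (mk_set_le M) hMc
    -- By maximality every non-empty `F a` meets `S`, so removing `S` lowers the size bound; inside
    -- `S` there are fewer than `κ` possible traces.
    let S : Set ι := ⋃ a : M, (F a : Set ι)
    have hS : #(Finset S) < κ := by
      have h1 : #S ≤ max #M ℵ₀ := by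
        refine (mk_iUnion_le_sum_mk).trans ((sum_le_mk_mul_iSup _).trans ?_)
        refine (mul_le_mul' le_rfl (ciSup_le' (a := ℵ₀) fun a => ?_)).trans ?_
        · exact (F a).finite_toSet.lt_aleph0.le
        · exact mul_le_max_of_aleph0_le_right le_rfl
      rcases finite_or_infinite S with h | h
      · exact (mk_lt_aleph0 (α := Finset S)).trans hκ
      · rw [mk_finset_of_infinite]
        exact h1.trans_lt (max_lt hMlt hκ)
    have hmeet : ∀ a, ((F a).filter (· ∉ S)).card ≤ n := by
      intro a
      by_cases hne : (F a) = ∅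
      · simp [hne]
      suffices h : ∃ i ∈ F a, i ∈ S by
        obtain ⟨i, hi, hiS⟩ := h
        refine Nat.lt_succ_iff.1 (lt_of_lt_of_le (Finset.card_lt_card ?_) (hF a))
        exact Finset.filter_ssubset.2 ⟨i, hi, by simpa using hiS⟩
      by_contra! hcon
      have hins : (insert a M).PairwiseDisjoint F := by
        refine hM.prop.insert fun b hb _ => Finset.disjoint_left.2 fun i hi hib => ?_
        exact hcon i hi (mem_iUnion.2 ⟨⟨b, hb⟩, hib⟩)
      have haM : a ∈ M := hM.le_of_ge hins (subset_insert a M) (mem_insert a M)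
      obtain ⟨i, hi⟩ := Finset.nonempty_iff_ne_empty.2 hne
      exact hcon i hi (mem_iUnion.2 ⟨⟨a, haM⟩, hi⟩)
    obtain ⟨J₁, hJ₁, m₁, c₁, hc₁⟩ := ih I (fun a => (F a).filter (· ∉ S)) hI hmeet
    obtain ⟨J₂, hJ₂, m₂, c₂, hc₂⟩ := H J₁ (fun a => (F a).filter (· ∈ S)) (hJ₁.trans hI) (by
      refine lt_of_le_of_lt (mk_le_mk_of_subset (t := range fun T : Finset S =>
        T.map (Function.Embedding.subtype _)) ?_) (mk_range_le.trans_lt hS)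
      rintro _ ⟨a, rfl⟩
      exact ⟨(F a).subtype (· ∈ S), by ext; simp [Finset.mem_filter]⟩)
    -- Disjoint palettes inside and outside `S` keep the glued colouring injective.
    refine ⟨Subtype.val '' J₂, ?_, m₂ + m₁,
      fun i => if i ∈ S then Fin.castAdd m₁ (c₂ i) else Fin.natAdd m₂ (c₁ i), ?_⟩
    · rw [mk_image_eq Subtype.val_injective, hJ₂, hJ₁]
    · rintro _ ⟨a, ha, rfl⟩ i hi j hj hij
      have h1 := hc₁ a a.2
      have h2 := hc₂ a ha
      by_cases hiS : i ∈ S <;> by_cases hjS : j ∈ S <;> simp only [hiS, hjS, if_true, if_false] at hij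
      · exact h2 (by simpa using ⟨hi, hiS⟩) (by simpa using ⟨hj, hjS⟩)
          (Fin.castAdd_injective _ _ hij)
      · have := congrArg Fin.val hij
        simp at this
        omega
      · have := congrArg Fin.val hij
        simp at this
        omega
      · exact h1 (by simpa using ⟨hi, hiS⟩) (by simpa using ⟨hj, hjS⟩)
          (Fin.natAdd_injective _ _ hij)

/-- For uncountable cofinality it is enough to treat finite sets of bounded size. -/
theorem ColorableFamily.of_card_le {ι : Type u} {κ : Cardinal.{u}} (hκ : ℵ₀ < κ.ord.cof)
    (H : ∀ (n : ℕ) (I : Type u) (F : I → Finset ι), #I = κ → (∀ a, (F a).card ≤ n) →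
      ColorableFamily F) (I : Type u) (F : I → Finset ι) (hI : #I = κ) : ColorableFamily F := by
  subst hI
  have hω : ℵ₀ ≤ #I := hκ.le.trans (Ordinal.cof_ord_le _)
  obtain ⟨⟨n⟩, hn⟩ := infinite_pigeonhole (fun a => ULift.up.{u} (F a).card) hω (by simpa using hκ)
  obtain ⟨J, hJ, m, c, hc⟩ := H n _ (fun a : ((fun a => ULift.up.{u} (F a).card) ⁻¹' {⟨n⟩} : Set I) => F a) hn
    (fun a => (congrArg ULift.down a.2).le)
  refine ⟨Subtype.val '' J, ?_, m, c, ?_⟩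
  · rw [mk_image_eq Subtype.val_injective, hJ, hn]
  · rintro _ ⟨a, ha, rfl⟩
    exact hc a ha

/-- With fewer than `κ` values, regularity forces one value to occur `κ` times. -/
theorem colorableFamily_of_isRegular {ι : Type u} {κ : Cardinal.{u}} (hκ : ℵ₀ < κ)
    (hr : κ.ord.cof = κ) (I : Type u) (F : I → Finset ι) (hI : #I = κ) : ColorableFamily F := by
  refine .of_card_le (hr.symm ▸ hκ) (ColorableFamily.of_few_values hκ ?_) I F hI
  intro I F hI hF
  subst hI
  obtain ⟨⟨s, _⟩, h⟩ := infinite_pigeonhole (rangeFactorization F) hκ.le (by rwa [hr])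
  refine .of_const F s ?_
  rw [← h]
  congr 2
  ext a
  simp [rangeFactorization, Subtype.ext_iff]

theorem exists_lt_mk_fiber {I β : Type u} (f : I → β) (hI : ℵ₀ ≤ #I) (hβ : #β < #I)
    {ρ : Cardinal.{u}} (hρ : ρ < #I) : ∃ b, ρ < #(f ⁻¹' {b}) := by
  by_contra! h
  apply (mk_univ (α := I)).not_lt
  rw [← preimage_univ (f := f), ← iUnion_of_singleton, preimage_iUnion]
  refine mk_iUnion_le_sum_mk.trans_lt ((sum_le_mk_mul_iSup _).trans_lt ?_)
  exact mul_lt_of_lt hI hβ ((ciSup_le' h).trans_lt hρ)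

/-- The colouring lemma: among `κ` finite sets, where `κ` has uncountable cofinality, there are
`κ` ones on which a single finite colouring is injective. -/
theorem colorableFamily {I ι : Type u} (F : I → Finset ι) (hκ : ℵ₀ < (#I).ord.cof) :
    ColorableFamily F := by
  have hω : ℵ₀ < #I := hκ.trans_le (Ordinal.cof_ord_le _)
  refine .of_card_le hκ (ColorableFamily.of_few_values hω ?_) I F rfl
  clear F
  generalize #I = κ at hκ hω
  intro I F hI hF
  subst hI
  -- Choose `s` cofinal of least order type, so that a subset of full size is unbounded in `s`. Each
  -- `x ∈ s` gets a value whose fibre exceeds the initial segment below `x`; the regular case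
  -- colours these values.
  obtain ⟨s, hs, hst⟩ := Ordinal.exists_ord_cof_eq (#I).ord.ToType
  rw [Ordinal.cof_toType] at hst
  have hsc : #s = (#I).ord.cof := by
    rw [← card_ord #s.Elem, ← card_ord (Ordinal.cof _), ← hst]; simp
  have hfib : ∀ x : s, ∃ t : Finset ι, #(Iio x.1) < #(F ⁻¹' {t}) := by
    intro x
    have hx : #(Iio x.1) < #I := by
      simpa using mk_Iio_lt x.1 (by simp)
    obtain ⟨⟨t, _⟩, h⟩ := exists_lt_mk_fiber (rangeFactorization F) hω.le hF hx
    refine ⟨t, h.trans_le (mk_le_mk_of_subset ?_)⟩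
    intro a ha
    exact congrArg Subtype.val ha
  choose G hG using hfib
  obtain ⟨J', hJ', m, c, hc⟩ := colorableFamily_of_isRegular hκ (Ordinal.cof_ord_cof _) s G hsc
  refine ⟨F ⁻¹' (G '' J'), ?_, m, c, ?_⟩
  · refine (mk_set_le _).antisymm ?_
    by_contra! hlt
    have hlt' : (#(F ⁻¹' (G '' J'))).ord < Ordinal.type (α := (#I).ord.ToType) (· < ·) := by
      simpa using hlt
    obtain ⟨y, hy⟩ := (Ordinal.typein_surj (α := (#I).ord.ToType) (· < ·)) hlt'
    have hyc : #(Iio y) = #(F ⁻¹' (G '' J')) := by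
      have := congrArg Ordinal.card hy
      rw [card_ord] at this
      rw [← this]
      rfl
    obtain ⟨x₀, hx₀, hyx₀⟩ := hs y
    obtain ⟨x, hx, hx₀x⟩ : ∃ x ∈ J', (⟨x₀, hx₀⟩ : s) ≤ x := by
      by_contra! h
      have h1 : #J' ≤ #(Iio (⟨x₀, hx₀⟩ : s)) := mk_le_mk_of_subset h
      have h2 := mk_Iio_lt (⟨x₀, hx₀⟩ : s) (by rw [hst, hsc])
      exact (h1.trans_lt h2).ne hJ'
    have h1 : #(Iio y) ≤ #(Iio x.1) :=
      mk_le_mk_of_subset (Iio_subset_Iio (hyx₀.trans hx₀x))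
    have h2 : #(F ⁻¹' {G x}) ≤ #(F ⁻¹' (G '' J')) :=
      mk_le_mk_of_subset (preimage_mono (singleton_subset_iff.2 ⟨x, hx, rfl⟩))
    exact ((h1.trans_lt (hG x)).trans_le h2).ne hyc
  · rintro a ⟨x, hx, hxa⟩
    rw [← hxa]
    exact hc x hx

/-! ### Chain conditions for indexed families -/

/-- The size of the subfamilies whose intersections witness a chain condition. -/
def ChainKind.Small : ChainKind → ∀ {I : Type u}, Set I → Prop
  | .C, _, _ => True
  | .P, _, T => T.Finite
  | .WP, _, T => ∃ a b, T = {a, b}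

theorem ChainKind.Small.image {A : ChainKind} {I I' : Type u} {T : Set I} (h : A.Small T)
    (f : I → I') : A.Small (f '' T) := by
  cases A with
  | C => trivial
  | P => exact Set.Finite.image f h
  | WP =>
    obtain ⟨a, b, rfl⟩ := h
    exact ⟨f a, f b, image_pair f a b⟩

/-- Puts the three conditions in one form, differing only in which index sets `T` are tested, so
that later arguments need no case split. -/
theorem ChainKind.good_image_iff (A : ChainKind) {X I : Type u} [Nonempty X] (U : I → Set X)
    (J : Set I) : A.Good (U '' J) ↔
      ∀ T ⊆ J, T.Nonempty → A.Small T → (⋂ t ∈ T, U t).Nonempty := by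
  cases A with
  | C =>
    simp only [ChainKind.Good, ChainKind.Small, sInter_image]
    constructor
    · exact fun h T hT _ _ => h.mono (biInter_subset_biInter_left hT)
    · intro h
      rcases J.eq_empty_or_nonempty with rfl | hJ
      · simp
      · exact h J subset_rfl hJ trivial
  | P =>
    simp only [ChainKind.Good, ChainKind.Small, IsCentered]
    constructor
    · intro h T hT hne hfin
      simpa using h (U '' T) (image_mono hT) (hfin.image U) (hne.image U)
    · intro h F hF hfin hne
      obtain ⟨T, hT, hTfin, rfl⟩ := (Set.exists_subset_image_finite_and (p := fun G => G = F)).1 ⟨F, hF, hfin, rfl⟩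
      simpa using h T hT (by simpa using hne) hTfin
  | WP =>
    simp only [ChainKind.Good, ChainKind.Small, IsLinked]
    constructor
    · rintro h _ hT - ⟨a, b, rfl⟩
      simpa using h _ ⟨a, hT (by simp), rfl⟩ _ ⟨b, hT (by simp), rfl⟩
    · rintro h _ ⟨a, ha, rfl⟩ _ ⟨b, hb, rfl⟩
      simpa using h {a, b} (by simp [insert_subset_iff, ha, hb]) (by simp) ⟨a, b, rfl⟩

theorem ChainKind.Good.image_subset {A : ChainKind} {X I : Type u} [Nonempty X] {U : I → Set X}
    {J J' : Set I} (h : A.Good (U '' J)) (hJ : J' ⊆ J) : A.Good (U '' J') := by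
  rw [A.good_image_iff] at h ⊢
  exact fun T hT => h T (hT.trans hJ)

theorem ChainKind.Good.image_mono {A : ChainKind} {X I : Type u} [Nonempty X] {U V : I → Set X}
    {J : Set I} (h : A.Good (U '' J)) (hUV : ∀ i ∈ J, U i ⊆ V i) : A.Good (V '' J) := by
  rw [A.good_image_iff] at h ⊢
  exact fun T hT hne hs => (h T hT hne hs).mono (iInter₂_mono fun i hi => hUV i (hT hi))

theorem ChainKind.Good.inter_nonempty {A : ChainKind} {X I : Type u} [Nonempty X] {U : I → Set X}
    {J : Set I} (h : A.Good (U '' J)) {a b : I} (ha : a ∈ J) (hb : b ∈ J) :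
    (U a ∩ U b).Nonempty := by
  rw [A.good_image_iff] at h
  have hs : A.Small ({a, b} : Set I) := by
    cases A with
    | C => trivial
    | P => exact toFinite _
    | WP => exact ⟨a, b, rfl⟩
  simpa using h {a, b} (by simp [insert_subset_iff, ha, hb]) (by simp) hs

/-- A chain condition can be applied simultaneously to finitely many families. -/
theorem ChainKind.exists_good_of_finite {A : ChainKind} {X I : Type u} {K : Type*} [TopologicalSpace X]
    [Nonempty X] [Finite K] (hκ : #I ∈ A.cardinals X) (V : K → I → Set X)
    (hV : ∀ k i, IsOpen (V k i) ∧ (V k i).Nonempty) :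
    ∃ J : Set I, #J = #I ∧ ∀ k, A.Good (V k '' J) := by
  classical
  cases nonempty_fintype K
  suffices h : ∀ s : Finset K, ∃ J : Set I, #J = #I ∧ ∀ k ∈ s, A.Good (V k '' J) by
    obtain ⟨J, hJ, h⟩ := h Finset.univ
    exact ⟨J, hJ, fun k => h k (Finset.mem_univ k)⟩
  intro s
  induction s using Finset.induction_on with
  | empty => exact ⟨Set.univ, mk_univ, by simp⟩
  | insert k s _ ih =>
    obtain ⟨J, hJ, h⟩ := ih
    obtain ⟨J', hJ', h'⟩ := hκ.2 J hJ (fun i => V k i) fun i => hV k i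
    refine ⟨Subtype.val '' J', by rw [mk_image_eq Subtype.val_injective, hJ'], fun l hl => ?_⟩
    rcases Finset.mem_insert.1 hl with rfl | hl
    · rwa [image_image]
    · exact (h l hl).image_subset (by simp)

/-! ### Powers -/

theorem exists_box_subset {X ι : Type u} [TopologicalSpace X] {U : Set (ι → X)} (hU : IsOpen U)
    (hne : U.Nonempty) : ∃ (F : Finset ι) (u : ι → Set X),
      (∀ i, IsOpen (u i) ∧ (u i).Nonempty) ∧ (F : Set ι).pi u ⊆ U := by
  classical
  obtain ⟨x, hx⟩ := hne
  obtain ⟨F, u, hu, h⟩ := isOpen_pi_iff.1 hU x hx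
  refine ⟨F, fun i => if i ∈ F then u i else univ, fun i => ?_, fun y hy => h fun i hi => ?_⟩
  · by_cases hi : i ∈ F
    · simpa [hi] using ⟨(hu i hi).1, _, (hu i hi).2⟩
    · simp only [hi, if_false]
      exact ⟨isOpen_univ, x i, mem_univ _⟩
  · have hi' : i ∈ F := hi
    simpa [hi'] using hy i hi

theorem ChainKind.mem_cardinals_pi {A : ChainKind} {X ι : Type u} [TopologicalSpace X] [Nonempty X]
    {κ : Cardinal.{u}} (hκ : κ ∈ A.cardinals X) (hcof : ℵ₀ < κ.ord.cof) :
    κ ∈ A.cardinals (ι → X) := by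
  classical
  refine ⟨hκ.1, ?_⟩
  rintro I rfl U hU
  choose F u hu hFu using fun a => exists_box_subset (hU a).1 (hU a).2
  obtain ⟨J, hJ, m, c, hc⟩ := colorableFamily F hcof
  -- At most one `i ∈ F a` has colour `k`, so this is that factor of the box, or the whole space if
  -- there is none.
  let V : Fin m → J → Set X := fun k a => ⋂ i ∈ (F a).filter (c · = k), u a i
  have huniq : ∀ (a : J) (i : ι), i ∈ F a → V (c i) a = u a i := by
    intro a i hi
    have : (F a).filter (c · = c i) = {i} := by
      ext j
      simp only [Finset.mem_filter, Finset.mem_singleton]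
      exact ⟨fun h => hc a a.2 h.1 hi h.2, fun h => by subst h; exact ⟨hi, rfl⟩⟩
    simp only [V, this, Finset.mem_singleton, iInter_iInter_eq_left]
  have hV : ∀ k a, IsOpen (V k a) ∧ (V k a).Nonempty := by
    intro k a
    refine ⟨isOpen_biInter_finset fun i _ => (hu a i).1, ?_⟩
    by_cases h : ∃ i ∈ F a, c i = k
    · obtain ⟨i, hi, rfl⟩ := h
      rw [huniq a i hi]
      exact (hu a i).2
    · have : (F a).filter (c · = k) = ∅ := by
        simpa [Finset.filter_eq_empty_iff] using h
      simp only [V, this, Finset.notMem_empty, iInter_false, iInter_univ, univ_nonempty]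
  obtain ⟨J', hJ', hgood⟩ := ChainKind.exists_good_of_finite (hJ.symm ▸ hκ) V hV
  refine ⟨Subtype.val '' J', by rw [mk_image_eq Subtype.val_injective, hJ', hJ], ?_⟩
  rw [image_image, A.good_image_iff]
  intro T hT hne hs
  choose x hx using fun k => (A.good_image_iff (V k) J').1 (hgood k) T hT hne hs
  refine ⟨fun i => x (c i), mem_iInter₂.2 fun a ha => hFu a fun i hi => ?_⟩
  rw [← huniq a i hi]
  exact mem_iInter₂.1 (hx (c i)) a ha

theorem ChainKind.cardinals_pi_subset {A : ChainKind} {X ι : Type u} [TopologicalSpace X]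
    [Nonempty X] [Nonempty ι] : A.cardinals (ι → X) ⊆ A.cardinals X := by
  rintro κ ⟨h0, h⟩
  refine ⟨h0, fun I hI U hU => ?_⟩
  obtain ⟨i⟩ := ‹Nonempty ι›
  obtain ⟨J, hJ, hgood⟩ := h I hI (fun a => (fun x => x i) ⁻¹' U a) fun a =>
    ⟨(hU a).1.preimage (continuous_apply i), (hU a).2.preimage (Function.surjective_eval i)⟩
  refine ⟨J, hJ, ?_⟩
  rw [A.good_image_iff] at hgood ⊢
  intro T hT hne hs
  obtain ⟨x, hx⟩ := hgood T hT hne hs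
  exact ⟨x i, mem_iInter₂.2 fun t ht => mem_iInter₂.1 hx t ht⟩

/-! ### Countable cofinality -/

theorem exists_nat_partition_of_cof_le {κ : Cardinal.{u}} (hκ : ℵ₀ ≤ κ) (h : κ.ord.cof ≤ ℵ₀) :
    ∃ (I : Type u) (f : I → ℕ), #I = κ ∧ ∀ n, #(f ⁻¹' {n}) < κ := by
  obtain ⟨s, hs, hsc⟩ := Order.exists_cof_eq κ.ord.ToType
  rw [Ordinal.cof_toType] at hsc
  obtain ⟨e⟩ : Nonempty (s ↪ ℕ) := by
    have : Countable s := mk_le_aleph0_iff.1 (hsc ▸ h)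
    exact ⟨⟨_, (exists_injective_nat s).choose_spec⟩⟩
  choose g hg hle using hs
  refine ⟨κ.ord.ToType, fun x => e ⟨g x, hg x⟩, by simp, fun n => ?_⟩
  by_cases hn : ∃ y : s, e y = n
  · obtain ⟨y, rfl⟩ := hn
    have h1 : #(Iic y.1) < κ := by
      have h2 : #(Iio y.1) < κ := by simpa using mk_Iio_lt y.1 (by simp)
      rw [← Iio_insert]
      exact mk_insert_le.trans_lt (add_lt_of_lt hκ h2 (one_lt_aleph0.trans_le hκ))
    refine (mk_le_mk_of_subset fun x hx => ?_).trans_lt h1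
    have : (⟨g x, hg x⟩ : s) = y := e.injective hx
    exact (hle x).trans (congrArg Subtype.val this).le
  · have : (fun x => e ⟨g x, hg x⟩) ⁻¹' {n} = ∅ := by
      ext x
      simpa using fun hx => hn ⟨_, hx⟩
    rw [this, mk_eq_zero]
    exact aleph0_pos.trans_le hκ

theorem ChainKind.aleph0_lt_cof_of_mem_cardinals {A : ChainKind} {X : Type u} [TopologicalSpace X]
    [T2Space X] [Infinite X] {κ : Cardinal.{u}} (hκ : κ ∈ A.cardinals X) : ℵ₀ < κ.ord.cof := by
  by_contra! hcof
  obtain ⟨I, f, hI, hf⟩ := exists_nat_partition_of_cof_le hκ.1 hcof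
  -- Repeat the `n`-th disjoint open set along the `n`-th piece of the partition: any good subfamily
  -- stays in one piece, hence is too small.
  obtain ⟨U, hinf, hop, hdisj⟩ := exists_seq_infinite_isOpen_pairwise_disjoint X
  obtain ⟨J, hJ, hgood⟩ := hκ.2 I hI (fun a => U (f a)) fun a => ⟨hop _, (hinf _).nonempty⟩
  have hJne : J.Nonempty := by
    rw [← mk_set_ne_zero_iff, hJ]
    exact (aleph0_pos.trans_le hκ.1).ne'
  obtain ⟨a, ha⟩ := hJne
  have hsub : J ⊆ f ⁻¹' {f a} := by
    intro b hb
    by_contra hne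
    have := hgood.inter_nonempty ha hb
    exact this.not_disjoint (hdisj fun h => hne h.symm)
  exact ((mk_le_mk_of_subset hsub).trans_lt (hf _)).ne hJ

/-! ### Collections of distinct open sets -/

/-- Sets of size at least `#I` have a system of distinct representatives indexed by `I`. -/
theorem exists_injective_mem_of_mk_le {I β : Type u} (S : I → Set β) (h : ∀ a, #I ≤ #(S a)) :
    ∃ f : I → β, Function.Injective f ∧ ∀ a, f a ∈ S a := by
  classical
  -- Initial segments of this well-order have size below `#I`, so a recursive choice always finds an
  -- unused element.
  obtain ⟨r, hr, hr'⟩ := exists_ord_eq I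
  have step : ∀ (a : I) (g : ∀ b, r b a → β), ∃ y ∈ S a, ∀ b hb, g b hb ≠ y := by
    intro a g
    by_contra! hcon
    have h1 : #(S a) ≤ #{b // r b a} := by
      refine (mk_le_mk_of_subset (t := range fun b : {b // r b a} => g b.1 b.2) ?_).trans
        mk_range_le
      intro y hy
      obtain ⟨b, hb, hby⟩ := hcon y hy
      exact ⟨⟨b, hb⟩, hby⟩
    have h2 : #{b // r b a} < #I := by
      have := Ordinal.typein_lt_type r a
      rw [← hr', lt_ord] at this
      exact this
    exact ((h a).trans h1).not_gt h2
  choose y hyS hy using step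
  let f : I → β := hr.wf.fix y
  have hf : ∀ a, f a = y a fun b _ => f b := fun a => hr.wf.fix_eq y a
  have hne : ∀ a b, r b a → f b ≠ f a := fun a b hab => by
    rw [hf a]
    exact hy a (fun b _ => f b) b hab
  refine ⟨f, fun a b hab => ?_, fun a => hf a ▸ hyS a _⟩
  rcases trichotomous_of r a b with h | h | h
  · exact absurd hab (hne b a h)
  · exact h
  · exact absurd hab.symm (hne a b h)

theorem ChainKind.cardinals_subset_starCardinals {A : ChainKind} {X : Type u}
    [TopologicalSpace X] : A.cardinals X ⊆ A.starCardinals X := by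
  rintro κ ⟨h0, h⟩
  refine ⟨h0, fun 𝒰 h𝒰 hU => ?_⟩
  obtain ⟨J, hJ, hgood⟩ := h 𝒰 h𝒰 (fun U => U) fun U => hU U U.2
  exact ⟨Subtype.val '' J, by simp, by rw [mk_image_eq Subtype.val_injective, hJ], hgood⟩

theorem le_mk_nonempty_opens {Y : Type u} [TopologicalSpace Y] {κ : Cardinal.{u}} (h0 : ℵ₀ ≤ κ)
    (hκ : κ ≤ numOpens Y) : κ ≤ #{W : Set Y | IsOpen W ∧ W.Nonempty} := by
  by_contra! hlt
  refine (hκ.trans ?_).not_gt (add_lt_of_lt h0 hlt (one_lt_aleph0.trans_le h0))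
  refine (mk_le_mk_of_subset (s := {W : Set Y | IsOpen W}) (fun W hW => ?_)).trans
    (mk_insert_le (a := ∅))
  rcases W.eq_empty_or_nonempty with h | h
  · exact Or.inl h
  · exact Or.inr ⟨hW, h⟩

/-- Every non-empty open subset of an infinite power has as many open subsets as the power. -/
theorem le_mk_nonempty_open_subsets {X ι : Type u} [TopologicalSpace X] [Infinite ι]
    {κ : Cardinal.{u}} (h0 : ℵ₀ ≤ κ) (hκ : κ ≤ numOpens (ι → X)) {U : Set (ι → X)} (hU : IsOpen U)
    (hne : U.Nonempty) : κ ≤ #{V : Set (ι → X) | IsOpen V ∧ V.Nonempty ∧ V ⊆ U} := by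
  classical
  obtain ⟨F, u, hu, hFu⟩ := exists_box_subset hU hne
  -- The coordinates off the support form a copy of the whole power, so its open sets embed below
  -- the box as cylinders.
  obtain ⟨e⟩ : Nonempty (ι ≃ ((F : Set ι)ᶜ : Set ι)) :=
    Cardinal.eq.1 (mk_compl_finset_of_infinite F).symm
  have hsurj : ∀ y : ι → X, ∃ x ∈ (F : Set ι).pi u, (fun i => x (e i)) = y := by
    intro y
    refine ⟨fun i => if h : i ∈ F then (hu i).2.some else y (e.symm ⟨i, by simpa using h⟩), ?_, ?_⟩
    · intro i hi
      have hi' : i ∈ F := hi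
      simpa [hi'] using (hu i).2.some_mem
    · ext i
      have hi : (e i : ι) ∉ F := (e i).2
      simp [hi]
  refine (le_mk_nonempty_opens h0 hκ).trans ?_
  let Φ : Set (ι → X) → Set (ι → X) := fun W => (F : Set ι).pi u ∩ (fun x i => x (e i)) ⁻¹' W
  have hΦ : Function.Injective Φ := by
    intro W W' h
    ext y
    obtain ⟨x, hx, rfl⟩ := hsurj y
    have := Set.ext_iff.1 h x
    simpa [Φ, hx] using this
  rw [← mk_image_eq hΦ]
  refine mk_le_mk_of_subset ?_
  rintro _ ⟨W, ⟨hW, y, hy⟩, rfl⟩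
  refine ⟨(isOpen_set_pi F.finite_toSet fun i _ => (hu i).1).inter
    (hW.preimage (by fun_prop)), ?_, inter_subset_left.trans hFu⟩
  obtain ⟨x, hx, rfl⟩ := hsurj y
  exact ⟨x, hx, hy⟩

theorem ChainKind.mem_cardinals_of_mem_starCardinals {A : ChainKind} {X ι : Type u}
    [TopologicalSpace X] [Nonempty X] [Infinite ι] {κ : Cardinal.{u}}
    (h : κ ∈ A.starCardinals (ι → X)) (hκ : κ ≤ numOpens (ι → X)) :
    κ ∈ A.cardinals (ι → X) := by
  refine ⟨h.1, ?_⟩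
  rintro I rfl U hU
  obtain ⟨V, hinj, hV⟩ := exists_injective_mem_of_mk_le
    (fun a => {V : Set (ι → X) | IsOpen V ∧ V.Nonempty ∧ V ⊆ U a})
    fun a => le_mk_nonempty_open_subsets h.1 hκ (hU a).1 (hU a).2
  obtain ⟨𝒱, h𝒱, hc, hgood⟩ := h.2 (range V) (mk_range_eq V hinj) (by
    rintro _ ⟨a, rfl⟩
    exact ⟨(hV a).1, (hV a).2.1⟩)
  refine ⟨V ⁻¹' 𝒱, by rw [mk_preimage_of_injective_of_subset_range V 𝒱 hinj h𝒱, hc], ?_⟩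
  refine ChainKind.Good.image_mono (U := V) ?_ fun a _ => (hV a).2.2
  rwa [image_preimage_eq_of_subset h𝒱]

end TopCaliber

theorem mainTheorem3 {X : Type u} [TopologicalSpace X] [T2Space X] [Nontrivial X]
    {ι : Type u} [Infinite ι] (φ : (Y : Type u) → [TopologicalSpace Y] → Cardinal.{u})
    (hφ : φ = @TopCaliber.weight ∨ φ = @TopCaliber.networkWeight)
    (ho : TopCaliber.numOpens X = 2 ^ φ X) (A : TopCaliber.ChainKind) :
    A.cardinals (ι → X) = {κ : Cardinal.{u} | κ ∈ A.cardinals X ∧ ℵ₀ < κ.ord.cof} ∧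
    A.starCardinals (ι → X) =
      {κ : Cardinal.{u} | ℵ₀ ≤ κ ∧ TopCaliber.numOpens (ι → X) < κ} ∪
      {κ : Cardinal.{u} | κ ∈ A.cardinals X ∧ κ ≤ TopCaliber.numOpens (ι → X) ∧
        ℵ₀ < κ.ord.cof} := by
  have h1 : A.cardinals (ι → X) = {κ : Cardinal.{u} | κ ∈ A.cardinals X ∧ ℵ₀ < κ.ord.cof} := by
    ext κ
    exact ⟨fun h => ⟨TopCaliber.ChainKind.cardinals_pi_subset h,
      TopCaliber.ChainKind.aleph0_lt_cof_of_mem_cardinals h⟩,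
      fun h => TopCaliber.ChainKind.mem_cardinals_pi h.1 h.2⟩
  refine ⟨h1, ?_⟩
  ext κ
  constructor
  · intro h
    rcases lt_or_ge (TopCaliber.numOpens (ι → X)) κ with hκ | hκ
    · exact Or.inl ⟨h.1, hκ⟩
    · have h2 := TopCaliber.ChainKind.mem_cardinals_of_mem_starCardinals h hκ
      rw [h1] at h2
      exact Or.inr ⟨h2.1, hκ, h2.2⟩
  · rintro (⟨h0, hκ⟩ | ⟨h, hκ, hcof⟩)
    · refine ⟨h0, fun 𝒰 h𝒰 hU => absurd hκ (not_lt.2 ?_)⟩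
      rw [← h𝒰]
      exact Cardinal.mk_le_mk_of_subset fun U hU' => (hU U hU').1
    · exact TopCaliber.ChainKind.cardinals_subset_starCardinals
        (TopCaliber.ChainKind.mem_cardinals_pi h hcof)
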